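/- Let $d\ge 1$ and let $\mathbf E\subset\mathbb R^d$ be a compact convex set with non-empty interior, equipped with its Borel $\sigma$-algebra. Let $\mathbf M$ be the set of all measures $m$ on $\mathbf E$ with $m(A)\in\{0,1,2,\dots\}$ for every Borel set $A\subseteq\mathbf E$, equipped with the $\sigma$-algebra generated by the maps $m\mapsto m(A)$. Let $\mathbf C$ be the family of all closed convex sets $C\subseteq\mathbf E$ with Lebesgue measure $|C|>0$. For $C\in\mathbf C$ and $\lambda>0$, a Poisson point process of intensity $\lambda$ on $C$ is a random element $\mathcal N$ of $\mathbf M$ such that $\mathcal N(A)$ has the Poisson distribution with parameter $\lambda|A\cap C|$ for every Borel set $A\subseteq\mathbf E$, and such that $\mathcal N(A_1),\dots,\mathcal N(A_n)$ are independent for all mutually disjoint Borel sets $A_1,\dots,A_n\subseteq\mathbf E$. Write $\mathbb E_C$ for the expectation when $\mathcal N$ is such a process. Then $$\liminf_{\lambda\to\infty}\ \lambda^{(d+3)/(d+1)}\ \inf_{\hat\theta_\lambda}\ \sup_{C\in\mathbf C}\ \mathbb E_C\big[(|C|-\hat\theta_\lambda(\mathcal N))^2\big]>0,$$ where, for each $\lambda$,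 the infimum extends over all estimators, i.e. all measurable functions $\hat\theta_\lambda:\mathbf M\to\mathbb R$. -/

import Mathlib

open MeasureTheory ProbabilityTheory
open scoped ENNReal NNReal

noncomputable section

namespace ConvexSupport

/-- Point measures on the state space `E`: measures on the Borel σ-algebra of `E` all of whose
values are natural numbers. As a subtype of `Measure E` the space of point measures carries the
σ-algebra generated by the evaluations `m ↦ m A`, `A` a measurable subset of `E`. -/
def PointMeasure {d : ℕ} (E : Set (EuclideanSpace ℝ (Fin d))) : Type :=
  {m : Measure E // ∀ A : Set E, MeasurableSet A → ∃ n : ℕ, m A = n}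

instance {d : ℕ} (E : Set (EuclideanSpace ℝ (Fin d))) : MeasurableSpace (PointMeasure E) :=
  inferInstanceAs
    (MeasurableSpace {m : Measure E // ∀ A : Set E, MeasurableSet A → ∃ n : ℕ, m A = n})

/-- The parameter class: closed convex subsets of `E` of positive Lebesgue measure. -/
def ConvexClass {d : ℕ} (E : Set (EuclideanSpace ℝ (Fin d))) :
    Set (Set (EuclideanSpace ℝ (Fin d))) :=
  {C | C ⊆ E ∧ Convex ℝ C ∧ IsClosed C ∧ 0 < volume C}

/-- `N` is, under the probability measure `P`, a Poisson point process with state space `E` of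
intensity `lam` on the set `C`. -/
structure IsPoissonPointProcess {d : ℕ} {E : Set (EuclideanSpace ℝ (Fin d))}
    {Ω : Type*} [MeasurableSpace Ω] (N : Ω → PointMeasure E) (P : Measure Ω)
    (lam : ℝ≥0) (C : Set (EuclideanSpace ℝ (Fin d))) : Prop where
  isProbabilityMeasure : IsProbabilityMeasure P
  measurable : Measurable N
  /-- `N(A)` is Poisson distributed with parameter `lam * |A ∩ C|`. -/
  count_law : ∀ A : Set E, MeasurableSet A →
    P.map (fun ω => (N ω).1 A) =
      (poissonMeasure (lam * (volume (Subtype.val '' A ∩ C)).toNNReal)).map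
        (fun k : ℕ => (k : ℝ≥0∞))
  /-- The counts of mutually disjoint sets are independent. -/
  indep : ∀ (n : ℕ) (A : Fin n → Set E), (∀ i, MeasurableSet (A i)) →
    Pairwise (fun i j => Disjoint (A i) (A j)) →
    iIndepFun (fun i ω => (N ω).1 (A i)) P

/-- The maximal mean squared error over the parameter class of an estimator `θ` of the volume,
`sup_C 𝔼_C[(|C| - θ(N))²]`, with values in `[0, ∞]`. For each `C`, the expectation is with respect
to the law `Q` of a Poisson point process of intensity `lam` on `C`. -/
def maxRisk {d : ℕ} (E : Set (EuclideanSpace ℝ (Fin d))) (lam : ℝ≥0)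
    (θ : PointMeasure E → ℝ) : ℝ≥0∞ :=
  ⨆ C ∈ ConvexClass E, ⨆ Q : Measure (PointMeasure E),
    ⨆ _ : IsPoissonPointProcess (id : PointMeasure E → PointMeasure E) Q lam C,
      ∫⁻ m, ENNReal.ofReal ((volume.real C - θ m) ^ 2) ∂Q

/-- The minimax squared risk for estimating `|C|` in the Poisson point process model of intensity
`lam`. The estimators are the measurable real functions of the observed point measure. -/
def minimaxRisk {d : ℕ} (E : Set (EuclideanSpace ℝ (Fin d))) (lam : ℝ≥0) : ℝ≥0∞ :=
  ⨅ θ : PointMeasure E → ℝ, ⨅ _ : Measurable θ, maxRisk E lam θ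

end ConvexSupport

end

/-!
The risk is averaged over a hypercube of bodies, obtained by cutting off subsets of a family of
disjoint caps of height `δ²` from a truncated paraboloid inside `E`. All the corresponding
processes are restrictions of a single Poisson process on the full body. When a cap contains no
point of that process, the observation does not reveal whether the cap was cut off. As the choices
for these caps are independent and uniform, each of them contributes at least the square of half
its volume to the mean squared error of every estimator. With `λ δ^(d+1) = 1` every cap has volume
of order `δ^(d+1)` and is empty with probability bounded below, and there is room for order
`δ^(-(d-1))` of them, so the risk is of order at least
`δ^(-(d-1)) * δ^(2*(d+1)) = δ^(d+3) = λ^(-(d+3)/(d+1))`.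
-/

noncomputable section

namespace ConvexSupport

section PoissonTuple

theorem cexp_sum_mul_indicator {X ι : Type*} [Fintype ι] {A : ι → Set X}
    (hdisj : Pairwise fun i j => Disjoint (A i) (A j)) (t : ι → ℝ) (x : X) :
    Complex.exp ((∑ j, t j * (A j).indicator (fun _ => (1 : ℝ)) x : ℝ) * Complex.I) =
      1 + ∑ j, (A j).indicator (fun _ => Complex.exp (t j * Complex.I) - 1) x := by
  by_cases hx : ∃ j, x ∈ A j
  · obtain ⟨j, hj⟩ := hx
    have hne : ∀ i, i ≠ j → x ∉ A i := fun i hi hxi => (hdisj hi).le_bot ⟨hxi, hj⟩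
    rw [Finset.sum_eq_single j (fun i _ hi => by simp [hne i hi]) (by simp),
      Finset.sum_eq_single j (fun i _ hi => by simp [hne i hi]) (by simp)]
    simp [hj]
  · push Not at hx
    simp [hx]

variable {X : Type*} [MeasurableSpace X]

/-- The counting measure, with multiplicities, of the entries of a finite tuple. -/
def tupleMeasure (x : Σ k, Fin k → X) : Measure X :=
  ∑ i, Measure.dirac (x.2 i)

theorem tupleMeasure_apply (x : Σ k, Fin k → X) {A : Set X} (hA : MeasurableSet A) :
    tupleMeasure x A = ∑ i, A.indicator 1 (x.2 i) := by
  rw [tupleMeasure, Measure.finsetSum_apply]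
  exact Finset.sum_congr rfl fun i _ => Measure.dirac_apply' _ hA

theorem tupleMeasure_real_apply (x : Σ k, Fin k → X) {A : Set X} (hA : MeasurableSet A) :
    (tupleMeasure x).real A = ∑ i, A.indicator (fun _ => (1 : ℝ)) (x.2 i) := by
  have hne : ∀ i ∈ Finset.univ, A.indicator (1 : X → ℝ≥0∞) (x.2 i) ≠ ∞ := fun i _ => by
    by_cases h : x.2 i ∈ A <;> simp [h]
  rw [measureReal_def, tupleMeasure_apply x hA, ENNReal.toReal_sum hne]
  refine Finset.sum_congr rfl fun i _ => ?_
  by_cases h : x.2 i ∈ A <;> simp [h]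

theorem exists_nat_eq_tupleMeasure_apply (x : Σ k, Fin k → X) {A : Set X} (hA : MeasurableSet A) :
    ∃ n : ℕ, tupleMeasure x A = n := by
  classical
  refine ⟨∑ i, if x.2 i ∈ A then 1 else 0, ?_⟩
  rw [tupleMeasure_apply x hA, Nat.cast_sum]
  refine Finset.sum_congr rfl fun i _ => ?_
  by_cases h : x.2 i ∈ A <;> simp [h]

theorem measurable_sigmaMk (k : ℕ) :
    Measurable fun x : Fin k → X => (⟨k, x⟩ : Σ k, Fin k → X) :=
  measurable_iff_le_map.2 (iInf_le _ k)

theorem measurable_of_comp_sigmaMk {Y : Type*} [MeasurableSpace Y] {f : (Σ k, Fin k → X) → Y}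
    (hf : ∀ k, Measurable fun x : Fin k → X => f ⟨k, x⟩) : Measurable f :=
  fun _ hs => MeasurableSpace.measurableSet_iInf.2 fun k => hf k hs

theorem measurable_tupleMeasure_apply {A : Set X} (hA : MeasurableSet A) :
    Measurable fun x : Σ k, Fin k → X => tupleMeasure x A := by
  simp_rw [tupleMeasure_apply _ hA]
  exact measurable_of_comp_sigmaMk fun k => Finset.univ.measurable_sum fun (i : Fin k) _ =>
    (measurable_one.indicator hA).comp (measurable_pi_apply i)

theorem measurable_tupleMeasure_real {A : Set X} (hA : MeasurableSet A) :
    Measurable fun x : Σ k, Fin k → X => (tupleMeasure x).real A :=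
  (measurable_tupleMeasure_apply hA).ennreal_toReal

/-- The law of a tuple with independent entries of law `κ / κ(X)` and Poisson distributed length of
parameter `κ(X)`. Its counting measure is a Poisson process with the finite intensity
measure `κ`. -/
def poissonTuple (κ : Measure X) : Measure (Σ k, Fin k → X) :=
  Measure.sum fun k => ENNReal.ofReal (Real.exp (-κ.real Set.univ) / k.factorial) •
    (Measure.pi fun _ : Fin k => κ).map fun x => ⟨k, x⟩

variable (κ : Measure X) [IsFiniteMeasure κ]

instance : IsProbabilityMeasure (poissonTuple κ) := by
  refine ⟨?_⟩
  have hterm : ∀ k : ℕ, (ENNReal.ofReal (Real.exp (-κ.real Set.univ) / k.factorial) •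
      (Measure.pi fun _ : Fin k => κ).map fun x => (⟨k, x⟩ : Σ k, Fin k → X)) Set.univ =
      ENNReal.ofReal (Real.exp (-κ.real Set.univ) * (κ.real Set.univ ^ k / k.factorial)) := by
    intro k
    rw [Measure.smul_apply, Measure.map_apply (measurable_sigmaMk k) MeasurableSet.univ,
      Set.preimage_univ, Measure.pi_univ, Finset.prod_const, Finset.card_univ, Fintype.card_fin,
      ← ofReal_measureReal (measure_ne_top κ _), ← ENNReal.ofReal_pow measureReal_nonneg,
      smul_eq_mul, ← ENNReal.ofReal_mul (by positivity), div_mul_eq_mul_div, mul_div_assoc]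
  rw [poissonTuple, Measure.sum_apply _ MeasurableSet.univ]
  simp_rw [hterm]
  rw [← ENNReal.ofReal_tsum_of_nonneg (fun k => by positivity)
    ((Real.summable_pow_div_factorial _).mul_left _), tsum_mul_left,
    ← congrFun (NormedSpace.exp_eq_tsum_div (𝔸 := ℝ)), ← Real.exp_eq_exp_ℝ, ← Real.exp_add,
    neg_add_cancel, Real.exp_zero, ENNReal.ofReal_one]

theorem integral_prod_poissonTuple {g : X → ℂ} (hg : Measurable g) (hg1 : ∀ x, ‖g x‖ ≤ 1) :
    ∫ x, ∏ i, g (x.2 i) ∂poissonTuple κ = Complex.exp (∫ x, g x ∂κ - κ.real Set.univ) := by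
  have hmeas : Measurable fun x : Σ k, Fin k → X => ∏ i, g (x.2 i) :=
    measurable_of_comp_sigmaMk fun k => Finset.univ.measurable_prod fun (i : Fin k) _ =>
      hg.comp (measurable_pi_apply i)
  have hint : Integrable (fun x : Σ k, Fin k → X => ∏ i, g (x.2 i)) (poissonTuple κ) := by
    refine Integrable.of_bound hmeas.aestronglyMeasurable 1 (.of_forall fun x => ?_)
    rw [norm_prod]
    exact Finset.prod_le_one (fun i _ => norm_nonneg _) fun i _ => hg1 _
  have hterm : ∀ k : ℕ, ∫ x : Σ k, Fin k → X, ∏ i, g (x.2 i)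
      ∂(ENNReal.ofReal (Real.exp (-κ.real Set.univ) / k.factorial) •
        (Measure.pi fun _ : Fin k => κ).map fun x => ⟨k, x⟩) =
      Complex.exp (-κ.real Set.univ) * ((∫ x, g x ∂κ) ^ k / k.factorial) := by
    intro k
    rw [integral_smul_measure, integral_map (measurable_sigmaMk k).aemeasurable
      hmeas.aestronglyMeasurable, integral_fintype_prod_eq_pow, Fintype.card_fin,
      ENNReal.toReal_ofReal (by positivity), Complex.real_smul]
    push_cast
    ring
  rw [poissonTuple] at hint ⊢
  rw [integral_sum_measure hint]
  simp_rw [hterm]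
  rw [tsum_mul_left, ← congrFun (NormedSpace.exp_eq_tsum_div (𝔸 := ℂ)), ← Complex.exp_eq_exp_ℂ,
    ← Complex.exp_add, neg_add_eq_sub]

variable {ι : Type*} {A : ι → Set X}

theorem integral_cexp_sum_tupleMeasure [Fintype ι] (hA : ∀ i, MeasurableSet (A i))
    (hdisj : Pairwise fun i j => Disjoint (A i) (A j)) (t : ι → ℝ) :
    ∫ x, Complex.exp ((∑ j, t j * (tupleMeasure x).real (A j) : ℝ) * Complex.I) ∂poissonTuple κ =
      ∏ j, Complex.exp (κ.real (A j) * (Complex.exp (t j * Complex.I) - 1)) := by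
  let g : X → ℂ := fun x =>
    Complex.exp ((∑ j, t j * (A j).indicator (fun _ => (1 : ℝ)) x : ℝ) * Complex.I)
  have hg : Measurable g := by
    have : ∀ j, Measurable ((A j).indicator fun _ => (1 : ℝ)) :=
      fun j => measurable_const.indicator (hA j)
    fun_prop
  have hprod : ∀ x : Σ k, Fin k → X,
      Complex.exp ((∑ j, t j * (tupleMeasure x).real (A j) : ℝ) * Complex.I) =
        ∏ i, g (x.2 i) := by
    intro x
    rw [← Complex.exp_sum, ← Finset.sum_mul, ← Complex.ofReal_sum, Finset.sum_comm]
    simp_rw [tupleMeasure_real_apply x (hA _), Finset.mul_sum]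
  have hint : ∀ j, Integrable ((A j).indicator
      fun _ => Complex.exp (t j * Complex.I) - 1) κ :=
    fun j => (integrable_const _).indicator (hA j)
  simp_rw [hprod]
  rw [integral_prod_poissonTuple κ hg fun x => (Complex.norm_exp_ofReal_mul_I _).le,
    ← Complex.exp_sum]
  simp_rw [g, cexp_sum_mul_indicator hdisj]
  rw [integral_add (integrable_const _) (integrable_finsetSum _ fun j _ => hint j),
    integral_finsetSum _ fun j _ => hint j]
  simp_rw [fun j => integral_indicator_const (μ := κ)
    (Complex.exp (t j * Complex.I) - 1) (hA j)]
  simp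

theorem map_tupleMeasure_real {A : Set X} (hA : MeasurableSet A) :
    (poissonTuple κ).map (fun x => (tupleMeasure x).real A) =
      (poissonMeasure (κ A).toNNReal).map (fun k : ℕ => (k : ℝ)) := by
  have hmeas := measurable_tupleMeasure_real hA
  have := Measure.isProbabilityMeasure_map (μ := poissonTuple κ) hmeas.aemeasurable
  refine Measure.ext_of_charFun (funext fun t => ?_)
  rw [charFun_map_cast_poissonMeasure, charFun_apply_real, integral_map hmeas.aemeasurable
    (by fun_prop)]
  have := integral_cexp_sum_tupleMeasure κ (ι := Unit) (A := fun _ => A) (fun _ => hA)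
    (fun i j h => (h (Subsingleton.elim _ _)).elim) (fun _ => t)
  simpa [measureReal_def, ENNReal.coe_toNNReal_eq_toReal] using this

theorem iIndepFun_tupleMeasure_real [Finite ι] (hA : ∀ i, MeasurableSet (A i))
    (hdisj : Pairwise fun i j => Disjoint (A i) (A j)) :
    iIndepFun (fun i x => (tupleMeasure x).real (A i)) (poissonTuple κ) := by
  have := Fintype.ofFinite ι
  have hmeas := fun i => measurable_tupleMeasure_real (hA i)
  have hvec : Measurable fun x : Σ k, Fin k → X =>
      WithLp.toLp 2 fun i => (tupleMeasure x).real (A i) :=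
    (WithLp.measurable_toLp 2 _).comp (measurable_pi_lambda _ hmeas)
  rw [iIndepFun_iff_charFun_pi fun i => (hmeas i).aemeasurable]
  intro t
  simp_rw [map_tupleMeasure_real κ (hA _), charFun_map_cast_poissonMeasure]
  rw [charFun_apply, integral_map hvec.aemeasurable (by fun_prop)]
  have := integral_cexp_sum_tupleMeasure κ hA hdisj t
  simpa [measureReal_def, PiLp.inner_apply, ENNReal.coe_toNNReal_eq_toReal] using this

end PoissonTuple

section PoissonPointProcess

variable {d : ℕ} {E : Set (EuclideanSpace ℝ (Fin d))}

namespace PointMeasure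

theorem measurable_count {A : Set E} (hA : MeasurableSet A) :
    Measurable fun m : PointMeasure E => m.1 A :=
  (Measure.measurable_coe hA).comp measurable_subtype_coe

theorem measurable_of_count {Ω : Type*} [MeasurableSpace Ω] {N : Ω → PointMeasure E}
    (h : ∀ A : Set E, MeasurableSet A → Measurable fun ω => (N ω).1 A) : Measurable N :=
  Measurable.subtype_mk (Measure.measurable_of_measurable_coe _ h)

theorem count_ne_top (m : PointMeasure E) {A : Set E} (hA : MeasurableSet A) : m.1 A ≠ ∞ := by
  obtain ⟨n, hn⟩ := m.2 A hA
  simp [hn]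

/-- The point measure retaining only the points of `m` in `C`. -/
def restrict (m : PointMeasure E) {C : Set (EuclideanSpace ℝ (Fin d))} (hC : MeasurableSet C) :
    PointMeasure E :=
  ⟨m.1.restrict (Subtype.val ⁻¹' C), fun A hA => by
    rw [Measure.restrict_apply hA]
    exact m.2 _ (hA.inter (measurable_subtype_coe hC))⟩

theorem restrict_apply (m : PointMeasure E) {C : Set (EuclideanSpace ℝ (Fin d))}
    (hC : MeasurableSet C) {A : Set E} (hA : MeasurableSet A) :
    (m.restrict hC).1 A = m.1 (A ∩ Subtype.val ⁻¹' C) :=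
  Measure.restrict_apply hA

end PointMeasure

/-- The point measure formed by the entries of a finite tuple. -/
def tuplePointMeasure (x : Σ k, Fin k → E) : PointMeasure E :=
  ⟨tupleMeasure x, fun _ hA => exists_nat_eq_tupleMeasure_apply x hA⟩

theorem map_tuplePointMeasure_count (κ : Measure E) [IsFiniteMeasure κ] {A : Set E}
    (hA : MeasurableSet A) :
    (poissonTuple κ).map (fun x => (tuplePointMeasure x).1 A) =
      (poissonMeasure (κ A).toNNReal).map (fun k : ℕ => (k : ℝ≥0∞)) := by
  have hreal : (fun x : Σ k, Fin k → E => (tuplePointMeasure x).1 A) =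
      ENNReal.ofReal ∘ fun x => (tupleMeasure x).real A :=
    funext fun x => (ENNReal.ofReal_toReal ((tuplePointMeasure x).count_ne_top hA)).symm
  rw [hreal, ← Measure.map_map ENNReal.measurable_ofReal (measurable_tupleMeasure_real hA),
    map_tupleMeasure_real κ hA, Measure.map_map ENNReal.measurable_ofReal (by fun_prop)]
  congr 1
  ext k
  simp

theorem iIndepFun_tuplePointMeasure_count (κ : Measure E) [IsFiniteMeasure κ] {ι : Type*}
    [Finite ι] {A : ι → Set E} (hA : ∀ i, MeasurableSet (A i))
    (hdisj : Pairwise fun i j => Disjoint (A i) (A j)) :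
    iIndepFun (fun i x => (tuplePointMeasure x).1 (A i)) (poissonTuple κ) := by
  convert (iIndepFun_tupleMeasure_real κ hA hdisj).comp (fun _ => ENNReal.ofReal)
    fun _ => ENNReal.measurable_ofReal using 3 with i x
  exact (ENNReal.ofReal_toReal ((tuplePointMeasure x).count_ne_top (hA i))).symm

theorem exists_isPoissonPointProcess {C : Set (EuclideanSpace ℝ (Fin d))} (hCE : C ⊆ E)
    (hC : MeasurableSet C) (hCfin : volume C ≠ ∞) (lam : ℝ≥0) :
    ∃ P : Measure (Σ k, Fin k → E), IsPoissonPointProcess tuplePointMeasure P lam C := by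
  have hincl : Measurable (Set.inclusion hCE) := measurable_subtype_coe.subtype_mk
  let κ : Measure E := lam • (Measure.comap (Subtype.val : C → _) volume).map (Set.inclusion hCE)
  have hκ : ∀ A : Set E, MeasurableSet A → κ A = lam * volume (Subtype.val '' A ∩ C) := by
    intro A hA
    have himage : Subtype.val '' (Set.inclusion hCE ⁻¹' A) = Subtype.val '' A ∩ C := by
      ext x
      simp only [Set.mem_image, Set.mem_preimage, Subtype.exists, Set.mem_inter_iff]
      exact ⟨fun ⟨y, hy, hyA, hyx⟩ => hyx ▸ ⟨⟨y, hCE hy, hyA, rfl⟩, hy⟩,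
        fun ⟨⟨y, _, hyA, hyx⟩, hx⟩ => ⟨y, hyx ▸ hx, hyA, hyx⟩⟩
    rw [Measure.smul_apply, Measure.map_apply hincl hA, comap_subtype_coe_apply hC, himage,
      ENNReal.smul_def, smul_eq_mul]
  have : IsFiniteMeasure κ := by
    refine ⟨?_⟩
    rw [hκ _ MeasurableSet.univ]
    exact ENNReal.mul_lt_top ENNReal.coe_lt_top
      ((measure_mono Set.inter_subset_right).trans_lt hCfin.lt_top)
  refine ⟨poissonTuple κ, inferInstance,
    PointMeasure.measurable_of_count fun A hA => measurable_tupleMeasure_apply hA,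
    fun A hA => ?_, fun n A hA hdisj => iIndepFun_tuplePointMeasure_count κ hA hdisj⟩
  rw [map_tuplePointMeasure_count κ hA, hκ A hA, ENNReal.toNNReal_mul, ENNReal.toNNReal_coe]

namespace IsPoissonPointProcess

variable {Ω : Type*} [MeasurableSpace Ω] {N : Ω → PointMeasure E} {P : Measure Ω} {lam : ℝ≥0}
  {K C : Set (EuclideanSpace ℝ (Fin d))}

theorem id_map (h : IsPoissonPointProcess N P lam C) :
    IsPoissonPointProcess (id : PointMeasure E → PointMeasure E) (P.map N) lam C := by
  have hN := h.measurable
  have := h.isProbabilityMeasure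
  have := Measure.isProbabilityMeasure_map (μ := P) hN.aemeasurable
  have hcount := fun {A : Set E} => PointMeasure.measurable_count (A := A)
  refine ⟨inferInstance, measurable_id, fun A hA => ?_, fun n A hA hdisj => ?_⟩
  · exact (Measure.map_map (hcount hA) hN).trans (h.count_law A hA)
  · have hvec : Measurable fun (m : PointMeasure E) i => m.1 (A i) :=
      measurable_pi_lambda _ fun i => hcount (hA i)
    have hind := (iIndepFun_iff_map_fun_eq_pi_map (f := fun i ω => (N ω).1 (A i))
      fun i => ((hcount (hA i)).comp hN).aemeasurable).1 (h.indep n A hA hdisj)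
    refine (iIndepFun_iff_map_fun_eq_pi_map fun i => (hcount (hA i)).aemeasurable).2 ?_
    exact (Measure.map_map hvec hN).trans <| hind.trans <| congrArg Measure.pi <|
      funext fun i => (Measure.map_map (hcount (hA i)) hN).symm

theorem restrict (h : IsPoissonPointProcess N P lam K) (hC : MeasurableSet C) (hCK : C ⊆ K) :
    IsPoissonPointProcess (fun ω => (N ω).restrict hC) P lam C := by
  have hC' : MeasurableSet (Subtype.val ⁻¹' C : Set E) := measurable_subtype_coe hC
  refine ⟨h.isProbabilityMeasure, PointMeasure.measurable_of_count fun A hA => ?_,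
    fun A hA => ?_, fun n A hA hdisj => ?_⟩
  · simp_rw [PointMeasure.restrict_apply _ hC hA]
    exact (PointMeasure.measurable_count (hA.inter hC')).comp h.measurable
  · simp_rw [PointMeasure.restrict_apply _ hC hA]
    rw [h.count_law _ (hA.inter hC'), Set.image_inter_preimage, Set.inter_assoc,
      Set.inter_eq_left.2 hCK]
  · simp_rw [PointMeasure.restrict_apply _ hC (hA _)]
    exact h.indep n _ (fun i => (hA i).inter hC') fun i j hij =>
      (hdisj hij).mono Set.inter_subset_left Set.inter_subset_left

theorem measure_count_eq_zero (h : IsPoissonPointProcess N P lam C) {A : Set E}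
    (hA : MeasurableSet A) :
    P {ω | (N ω).1 A = 0} =
      ENNReal.ofReal (Real.exp (-(lam * volume.real (Subtype.val '' A ∩ C)))) := by
  have hlaw := congrArg (fun μ : Measure ℝ≥0∞ => μ {0}) (h.count_law A hA)
  have hcast : (fun k : ℕ => (k : ℝ≥0∞)) ⁻¹' {0} = {0} := by ext k; simp
  have hmeas : Measurable fun ω => (N ω).1 A := (PointMeasure.measurable_count hA).comp h.measurable
  simp only [Measure.map_apply hmeas (measurableSet_singleton _),
    Measure.map_apply (measurable_of_countable _) (measurableSet_singleton _), hcast,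
    poissonMeasure_singleton] at hlaw
  refine hlaw.trans ?_
  simp [measureReal_def, ENNReal.coe_toNNReal_eq_toReal]

open Classical in
theorem lintegral_sum_filter_count_eq_zero (h : IsPoissonPointProcess N P lam C)
    {ι : Type*} [Fintype ι] {A : ι → Set E} (hA : ∀ i, MeasurableSet (A i)) {w : ι → ℝ}
    (hw : ∀ i, 0 ≤ w i) :
    ∫⁻ ω, ENNReal.ofReal (∑ i with (N ω).1 (A i) = 0, w i) ∂P =
      ∑ i, ENNReal.ofReal
        (w i * Real.exp (-(lam * volume.real (Subtype.val '' A i ∩ C)))) := by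
  have hvoid : ∀ i, MeasurableSet {ω | (N ω).1 (A i) = 0} := fun i =>
    ((PointMeasure.measurable_count (hA i)).comp h.measurable) (measurableSet_singleton 0)
  have hindicator : ∀ ω, ENNReal.ofReal (∑ i with (N ω).1 (A i) = 0, w i) =
      ∑ i, {ω | (N ω).1 (A i) = 0}.indicator (fun _ => ENNReal.ofReal (w i)) ω := fun ω => by
    rw [ENNReal.ofReal_sum_of_nonneg fun i _ => hw i, Finset.sum_filter]
    simp only [Set.indicator_apply, Set.mem_ofPred_eq]
  simp_rw [hindicator]
  rw [lintegral_finsetSum _ fun i _ => measurable_const.indicator (hvoid i)]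
  refine Finset.sum_congr rfl fun i _ => ?_
  rw [lintegral_indicator_const (hvoid i), h.measure_count_eq_zero (hA i),
    ENNReal.ofReal_mul (hw i)]

theorem lintegral_sq_sub_le_maxRisk (h : IsPoissonPointProcess N P lam C) (hC : C ∈ ConvexClass E)
    {θ : PointMeasure E → ℝ} (hθ : Measurable θ) :
    ∫⁻ ω, ENNReal.ofReal ((volume.real C - θ (N ω)) ^ 2) ∂P ≤ maxRisk E lam θ := by
  rw [← lintegral_map (f := fun m => ENNReal.ofReal ((volume.real C - θ m) ^ 2)) (by fun_prop)
    h.measurable]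
  exact le_iSup₂_of_le C hC (le_iSup₂_of_le (P.map N) h.id_map le_rfl)

end IsPoissonPointProcess

end PoissonPointProcess

open scoped symmDiff

section SubsetAverage

variable {ι : Type*} [DecidableEq ι]

theorem sum_eq_sum_update_zero_add (v : ι → ℝ) (j : ι) (s : Finset ι) :
    ∑ i ∈ s, v i = ∑ i ∈ s, Function.update v j 0 i + if j ∈ s then v j else 0 := by
  rw [← Finset.sum_ite_eq' s j v, ← Finset.sum_add_distrib]
  refine Finset.sum_congr rfl fun i _ => ?_
  by_cases hij : i = j <;> simp [hij]

theorem sum_symmDiff_singleton_update_zero (v : ι → ℝ) (j : ι) (s : Finset ι) :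
    ∑ i ∈ s ∆ {j}, Function.update v j 0 i = ∑ i ∈ s, Function.update v j 0 i := by
  have hzero : Function.update v j 0 j = 0 := Function.update_self ..
  have herase : (s ∆ {j}).erase j = s.erase j := by
    ext i
    simp only [Finset.mem_erase, Finset.mem_symmDiff, Finset.mem_singleton]
    tauto
  rw [← Finset.sum_erase _ hzero, herase, Finset.sum_erase _ hzero]

theorem sum_sq_sub_eq_sum_sq_sub_update_zero [Fintype ι] (v : ι → ℝ) {f : Finset ι → ℝ} {j : ι}
    (hf : ∀ s, f (s ∆ {j}) = f s) :
    ∑ s, (f s - ∑ i ∈ s, v i) ^ 2 =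
      ∑ s, (f s - v j / 2 - ∑ i ∈ s, Function.update v j 0 i) ^ 2 +
        2 ^ Fintype.card ι * (v j ^ 2 / 4) := by
  have hflip : ∑ s, (f s - ∑ i ∈ s, v i) ^ 2 = ∑ s, (f s - ∑ i ∈ s ∆ {j}, v i) ^ 2 := by
    rw [← Equiv.sum_comp (symmDiff_left_involutive ({j} : Finset ι)).toPerm]
    simp only [Function.Involutive.coe_toPerm, hf]
  have hpair : ∀ s, (f s - ∑ i ∈ s, v i) ^ 2 + (f s - ∑ i ∈ s ∆ {j}, v i) ^ 2 =
      2 * (f s - v j / 2 - ∑ i ∈ s, Function.update v j 0 i) ^ 2 + v j ^ 2 / 2 := by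
    intro s
    rw [sum_eq_sum_update_zero_add v j s, sum_eq_sum_update_zero_add v j (s ∆ {j}),
      sum_symmDiff_singleton_update_zero]
    have hmem : j ∈ s ∆ {j} ↔ j ∉ s := by simp [Finset.mem_symmDiff]
    by_cases hj : j ∈ s
    · rw [if_pos hj, if_neg (hmem.not_left.2 hj)]
      ring
    · rw [if_neg hj, if_pos (hmem.2 hj)]
      ring
  have hsum := Finset.sum_congr (s₁ := Finset.univ) rfl fun s _ => hpair s
  rw [Finset.sum_add_distrib, ← hflip, Finset.sum_add_distrib, ← Finset.mul_sum, Finset.sum_const,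
    Finset.card_univ, Fintype.card_finset, nsmul_eq_mul] at hsum
  push_cast at hsum
  linarith

theorem le_sum_sq_sub_of_symmDiff_invariant [Fintype ι] (J : Finset ι) (v : ι → ℝ)
    {f : Finset ι → ℝ} (hf : ∀ i ∈ J, ∀ s, f (s ∆ {i}) = f s) :
    2 ^ Fintype.card ι * ∑ i ∈ J, v i ^ 2 / 4 ≤ ∑ s, (f s - ∑ i ∈ s, v i) ^ 2 := by
  induction J using Finset.induction_on generalizing v f with
  | empty => simpa using Finset.sum_nonneg fun s _ => sq_nonneg (f s - ∑ i ∈ s, v i)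
  | insert j J hj ih =>
    have hrest := ih (Function.update v j 0) (f := fun s => f s - v j / 2) fun i hi s => by
      rw [hf i (Finset.mem_insert_of_mem hi)]
    have hupdate : ∑ i ∈ J, Function.update v j 0 i ^ 2 / 4 = ∑ i ∈ J, v i ^ 2 / 4 :=
      Finset.sum_congr rfl fun i hi => by
        rw [Function.update_of_ne (ne_of_mem_of_not_mem hi hj)]
    rw [sum_sq_sub_eq_sum_sq_sub_update_zero v (hf j (Finset.mem_insert_self j J)),
      Finset.sum_insert hj]
    rw [hupdate] at hrest
    linarith

end SubsetAverage

section Prune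

variable {α ι : Type*}

/-- The set `K` with the pieces `D i`, `i ∈ s`, cut off. -/
def prune (K : Set α) (D : ι → Set α) (s : Finset ι) : Set α :=
  K \ ⋃ i ∈ s, D i

theorem prune_subset (K : Set α) (D : ι → Set α) (s : Finset ι) : prune K D s ⊆ K :=
  Set.sdiff_subset

theorem prune_empty (K : Set α) (D : ι → Set α) : prune K D ∅ = K := by
  simp [prune]

theorem preimage_prune {β : Type*} (f : β → α) (K : Set α) (D : ι → Set α) (s : Finset ι) :
    f ⁻¹' prune K D s = prune (f ⁻¹' K) (fun i => f ⁻¹' D i) s := by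
  simp only [prune, Set.preimage_sdiff, Set.preimage_iUnion]

theorem mem_prune_symmDiff_singleton_iff [DecidableEq ι] {K : Set α} {D : ι → Set α} {i : ι}
    {x : α} (hx : x ∉ D i) (s : Finset ι) : x ∈ prune K D (s ∆ {i}) ↔ x ∈ prune K D s := by
  have hmem : ∀ t : Finset ι, x ∈ prune K D t ↔ x ∈ K ∧ ∀ j ∈ t, x ∉ D j := by simp [prune]
  have hne : ∀ j, x ∈ D j → j ≠ i := fun j hj hji => hx (hji ▸ hj)
  simp only [hmem, Finset.mem_symmDiff, Finset.mem_singleton]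
  grind

theorem measureReal_prune [MeasurableSpace α] {μ : Measure α} {K : Set α} (hK : μ K ≠ ∞)
    {D : ι → Set α} (hD : ∀ i, MeasurableSet (D i)) (hDK : ∀ i, D i ⊆ K)
    (hdisj : Pairwise fun i j => Disjoint (D i) (D j)) (s : Finset ι) :
    μ.real (prune K D s) = μ.real K - ∑ i ∈ s, μ.real (D i) := by
  rw [prune, measureReal_sdiff (Set.iUnion₂_subset fun i _ => hDK i)
      (s.measurableSet_biUnion fun i _ => hD i) hK,
    measureReal_biUnion_finset (hdisj.set_pairwise _) (fun i _ => hD i)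
      fun i _ => measure_ne_top_of_subset (hDK i) hK]

end Prune

section PrunedSupport

variable {d : ℕ} {E : Set (EuclideanSpace ℝ (Fin d))} {ι : Type*}
  {K : Set (EuclideanSpace ℝ (Fin d))} {D : ι → Set (EuclideanSpace ℝ (Fin d))}

theorem restrict_prune_symmDiff_singleton [DecidableEq ι]
    (hmeas : ∀ s, MeasurableSet (prune K D s)) (m : PointMeasure E) {i : ι}
    (hi : m.1 (Subtype.val ⁻¹' D i) = 0) (s : Finset ι) :
    m.restrict (hmeas (s ∆ {i})) = m.restrict (hmeas s) := by
  refine Subtype.ext (Measure.restrict_congr_set ?_)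
  filter_upwards [measure_eq_zero_iff_ae_notMem.1 hi] with x hx
  exact propext (mem_prune_symmDiff_singleton_iff (D := D) hx s)

variable [Fintype ι]

theorem le_sum_sq_measureReal_prune_sub (hKfin : volume K ≠ ∞) (hD : ∀ i, MeasurableSet (D i))
    (hDK : ∀ i, D i ⊆ K) (hdisj : Pairwise fun i j => Disjoint (D i) (D j))
    (hmeas : ∀ s, MeasurableSet (prune K D s)) (θ : PointMeasure E → ℝ) (m : PointMeasure E)
    (J : Finset ι) (hJ : ∀ i ∈ J, m.1 (Subtype.val ⁻¹' D i) = 0) :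
    2 ^ Fintype.card ι * ∑ i ∈ J, volume.real (D i) ^ 2 / 4 ≤
      ∑ s, (volume.real (prune K D s) - θ (m.restrict (hmeas s))) ^ 2 := by
  classical
  convert le_sum_sq_sub_of_symmDiff_invariant J (fun i => volume.real (D i))
    (f := fun s => volume.real K - θ (m.restrict (hmeas s))) fun i hi s => by
      rw [restrict_prune_symmDiff_singleton hmeas m (hJ i hi)] using 3 with s
  rw [measureReal_prune hKfin hD hDK hdisj]
  ring

theorem IsPoissonPointProcess.sum_sq_mul_exp_le_maxRisk {Ω : Type*} [MeasurableSpace Ω]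
    {N : Ω → PointMeasure E} {P : Measure Ω} {lam : ℝ≥0} (hN : IsPoissonPointProcess N P lam K)
    (hKfin : volume K ≠ ∞) (hD : ∀ i, MeasurableSet (D i)) (hDK : ∀ i, D i ⊆ K)
    (hdisj : Pairwise fun i j => Disjoint (D i) (D j))
    (hC : ∀ s, prune K D s ∈ ConvexClass E) {θ : PointMeasure E → ℝ} (hθ : Measurable θ) :
    ∑ i, ENNReal.ofReal
        (volume.real (D i) ^ 2 / 4 * Real.exp (-(lam * volume.real (D i)))) ≤
      maxRisk E lam θ := by
  classical
  have hKE : K ⊆ E := prune_empty K D ▸ (hC ∅).1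
  have hmeas : ∀ s, MeasurableSet (prune K D s) := fun s => (hC s).2.2.1.measurableSet
  have hNs := fun s => hN.restrict (hmeas s) (prune_subset K D s)
  have hDK' : ∀ i, Subtype.val '' (Subtype.val ⁻¹' D i : Set E) ∩ K = D i := fun i => by
    rw [Subtype.image_preimage_coe, Set.inter_eq_right.2 ((hDK i).trans hKE),
      Set.inter_eq_left.2 (hDK i)]
  have hvoid := hN.lintegral_sum_filter_count_eq_zero (fun i => measurable_subtype_coe (hD i))
    (w := fun i => volume.real (D i) ^ 2 / 4) fun i => by positivity
  simp_rw [hDK'] at hvoid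
  let R : Finset ι → Ω → ℝ := fun s ω =>
    (volume.real (prune K D s) - θ ((N ω).restrict (hmeas s))) ^ 2
  have hR : ∀ s, Measurable (R s) :=
    fun s => ((hθ.comp (hNs s).measurable).const_sub _).pow_const 2
  refine (ENNReal.mul_le_mul_iff_right (a := 2 ^ Fintype.card ι) (by simp) (by simp)).1 ?_
  calc 2 ^ Fintype.card ι * ∑ i, ENNReal.ofReal
        (volume.real (D i) ^ 2 / 4 * Real.exp (-(lam * volume.real (D i))))
      = ∫⁻ ω, 2 ^ Fintype.card ι * ENNReal.ofReal
          (∑ i with (N ω).1 (Subtype.val ⁻¹' D i) = 0, volume.real (D i) ^ 2 / 4) ∂P := by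
        rw [lintegral_const_mul' _ _ (by simp), hvoid]
    _ ≤ ∫⁻ ω, ∑ s, ENNReal.ofReal (R s ω) ∂P := by
        refine lintegral_mono fun ω => ?_
        have hbound := le_sum_sq_measureReal_prune_sub hKfin hD hDK hdisj hmeas θ (N ω)
          {i | (N ω).1 (Subtype.val ⁻¹' D i) = 0} fun i hi => (Finset.mem_filter.1 hi).2
        simpa [ENNReal.ofReal_mul, ENNReal.ofReal_sum_of_nonneg, R, sq_nonneg]
          using ENNReal.ofReal_le_ofReal hbound
    _ = ∑ s, ∫⁻ ω, ENNReal.ofReal (R s ω) ∂P :=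
        lintegral_finsetSum _ fun s _ => (hR s).ennreal_ofReal
    _ ≤ 2 ^ Fintype.card ι * maxRisk E lam θ := by
        simpa using Finset.sum_le_card_nsmul Finset.univ _ _ fun s _ =>
          (hNs s).lintegral_sq_sub_le_maxRisk (hC s) hθ

theorem sum_sq_mul_exp_le_minimaxRisk (hKfin : volume K ≠ ∞) (hD : ∀ i, MeasurableSet (D i))
    (hDK : ∀ i, D i ⊆ K) (hdisj : Pairwise fun i j => Disjoint (D i) (D j))
    (hC : ∀ s, prune K D s ∈ ConvexClass E) (lam : ℝ≥0) :
    ∑ i, ENNReal.ofReal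
        (volume.real (D i) ^ 2 / 4 * Real.exp (-(lam * volume.real (D i)))) ≤
      minimaxRisk E lam := by
  have hK := hC ∅
  rw [prune_empty] at hK
  obtain ⟨P, hN⟩ := exists_isPoissonPointProcess hK.1 hK.2.2.1.measurableSet hKfin lam
  exact le_iInf₂ fun θ hθ => hN.sum_sq_mul_exp_le_maxRisk hKfin hD hDK hdisj hC hθ

end PrunedSupport

section Paraboloid

open scoped RealInnerProductSpace

variable {F : Type*} [NormedAddCommGroup F]

variable (F) in
/-- The solid paraboloid `{(y, t) | ‖y‖² ≤ t}`. -/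
def paraboloid : Set (F × ℝ) :=
  {z | ‖z.1‖ ^ 2 ≤ z.2}

theorem isClosed_paraboloid : IsClosed (paraboloid F) :=
  isClosed_le (by fun_prop) (by fun_prop)

theorem convex_paraboloid [NormedSpace ℝ F] : Convex ℝ (paraboloid F) := by
  simpa [paraboloid] using
    ((convexOn_univ_norm (E := F)).pow (fun x _ => norm_nonneg x) 2).convex_epigraph

theorem lintegral_comp_smul [NormedSpace ℝ F] [MeasurableSpace F] [BorelSpace F]
    [FiniteDimensional ℝ F] (μ : Measure F) [μ.IsAddHaarMeasure] {f : F → ℝ≥0∞}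
    (hf : Measurable f) {r : ℝ} (hr : 0 < r) :
    ∫⁻ y, f y ∂μ = ENNReal.ofReal (r ^ Module.finrank ℝ F) * ∫⁻ y, f (r • y) ∂μ := by
  rw [← lintegral_map hf (measurable_const_smul r), Measure.map_addHaar_smul μ hr.ne',
    lintegral_smul_measure, smul_eq_mul, ← mul_assoc, ← ENNReal.ofReal_mul (by positivity),
    abs_of_pos (by positivity), mul_inv_cancel₀ (by positivity), ENNReal.ofReal_one, one_mul]

variable [InnerProductSpace ℝ F]

/-- The height of a point above the hyperplane tangent to the paraboloid at `(c, ‖c‖²)`. -/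
def tangentGap (c : F) (z : F × ℝ) : ℝ :=
  z.2 - 2 * ⟪c, z.1⟫ + ‖c‖ ^ 2

/-- The cap of height `δ²` of the paraboloid at `(c, ‖c‖²)`. -/
def cap (δ : ℝ) (c : F) : Set (F × ℝ) :=
  {z ∈ paraboloid F | tangentGap c z < δ ^ 2}

theorem tangentGap_eq (c : F) (z : F × ℝ) :
    tangentGap c z = z.2 - ‖z.1‖ ^ 2 + ‖z.1 - c‖ ^ 2 := by
  rw [tangentGap, norm_sub_sq_real, real_inner_comm]
  ring

@[fun_prop]
theorem continuous_tangentGap (c : F) : Continuous (tangentGap c) := by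
  unfold tangentGap
  fun_prop

theorem convex_le_tangentGap (c : F) (r : ℝ) : Convex ℝ {z | r ≤ tangentGap c z} := by
  have hlin : IsLinearMap ℝ fun z : F × ℝ => z.2 - 2 * ⟪c, z.1⟫ :=
    ⟨fun x y => by simp [inner_add_right]; ring, fun a x => by simp [inner_smul_right]; ring⟩
  have hset : {z | r ≤ tangentGap c z} = {z | r - ‖c‖ ^ 2 ≤ z.2 - 2 * ⟪c, z.1⟫} := by
    ext z
    exact (sub_le_iff_le_add (a := r)).symm
  rw [hset]
  exact convex_halfSpace_ge hlin _

theorem measurableSet_cap [MeasurableSpace F] [BorelSpace F] [SecondCountableTopology F]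
    (δ : ℝ) (c : F) : MeasurableSet (cap δ c) :=
  isClosed_paraboloid.measurableSet.inter
    (isOpen_lt (continuous_tangentGap c) continuous_const).measurableSet

theorem mem_cap_iff {δ : ℝ} {c : F} {z : F × ℝ} :
    z ∈ cap δ c ↔ ‖z.1‖ ^ 2 ≤ z.2 ∧ z.2 < ‖z.1‖ ^ 2 + (δ ^ 2 - ‖z.1 - c‖ ^ 2) := by
  refine and_congr_right fun _ => ?_
  rw [tangentGap_eq]
  constructor <;> intro h <;> linarith

theorem norm_sub_lt_of_mem_cap {δ : ℝ} (hδ : 0 ≤ δ) {c : F} {z : F × ℝ} (hz : z ∈ cap δ c) :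
    ‖z.1 - c‖ < δ := by
  obtain ⟨hle, hlt⟩ := mem_cap_iff.1 hz
  exact lt_of_pow_lt_pow_left₀ 2 hδ (by linarith)

theorem disjoint_cap {δ : ℝ} (hδ : 0 ≤ δ) {c c' : F} (h : 2 * δ ≤ dist c c') :
    Disjoint (cap δ c) (cap δ c') := by
  refine Set.disjoint_left.2 fun z hz hz' => h.not_gt ?_
  have := norm_sub_lt_of_mem_cap hδ hz
  have := norm_sub_lt_of_mem_cap hδ hz'
  have := dist_triangle_left c c' z.1
  rw [dist_eq_norm z.1, dist_eq_norm z.1] at this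
  linarith

theorem cap_subset_closedBall {δ a : ℝ} (hδ : 0 ≤ δ) (hδa : δ ≤ a) (ha : a ≤ 1) {c : F}
    (hc : ‖c‖ ≤ a) : cap δ c ⊆ Metric.closedBall 0 (5 * a) := by
  intro z hz
  have hz1 : ‖z.1‖ ≤ 2 * a := by
    have := norm_sub_lt_of_mem_cap hδ hz
    have := norm_le_norm_add_norm_sub' z.1 c
    linarith
  obtain ⟨hle, hlt⟩ := mem_cap_iff.1 hz
  have hz2 : |z.2| ≤ 5 * a := by
    rw [abs_of_nonneg ((sq_nonneg _).trans hle)]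
    nlinarith [sq_nonneg ‖z.1 - c‖, norm_nonneg z.1]
  exact mem_closedBall_zero_iff.2 (max_le (by linarith) hz2)

section CutCaps

variable {ι : Type*} {K : Set (F × ℝ)} {δ : ℝ}

theorem prune_cap (hK : K ⊆ paraboloid F) (δ : ℝ) (c : ι → F) (s : Finset ι) :
    prune K (fun i => cap δ (c i)) s = K ∩ ⋂ i ∈ s, {z | δ ^ 2 ≤ tangentGap (c i) z} := by
  ext z
  simp only [prune, cap, Set.mem_sdiff, Set.mem_iUnion, Set.mem_inter_iff, Set.mem_iInter,
    Set.mem_ofPred_eq, not_exists, not_and, not_lt]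
  exact and_congr_right fun hz => forall₂_congr fun _ _ => ⟨fun h => h (hK hz), fun h _ => h⟩

theorem convex_prune_cap (hK : K ⊆ paraboloid F) (hconv : Convex ℝ K) (c : ι → F)
    (s : Finset ι) : Convex ℝ (prune K (fun i => cap δ (c i)) s) := by
  rw [prune_cap hK]
  exact hconv.inter (convex_iInter₂ fun i _ => convex_le_tangentGap (c i) _)

theorem isClosed_prune_cap (hK : K ⊆ paraboloid F) (hclosed : IsClosed K) (c : ι → F)
    (s : Finset ι) : IsClosed (prune K (fun i => cap δ (c i)) s) := by
  rw [prune_cap hK]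
  exact hclosed.inter (isClosed_biInter fun i _ => isClosed_le (by fun_prop) (by fun_prop))

theorem measure_prune_cap_pos [MeasurableSpace F] (μ : Measure (F × ℝ)) [μ.IsOpenPosMeasure]
    {ρ : ℝ} (hδ : δ ^ 2 < ρ) (c : ι → F) (s : Finset ι) :
    0 < μ (prune (Metric.closedBall 0 ρ ∩ paraboloid F) (fun i => cap δ (c i)) s) := by
  let U : Set (F × ℝ) := Metric.ball 0 ρ ∩ {z | ‖z.1‖ ^ 2 + δ ^ 2 < z.2}
  have hU : IsOpen U := Metric.isOpen_ball.inter (isOpen_lt (by fun_prop) (by fun_prop))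
  have hne : U.Nonempty := by
    obtain ⟨t, hδt, htρ⟩ := exists_between hδ
    have ht : 0 ≤ t := (sq_nonneg δ).trans hδt.le
    refine ⟨(0, t), ?_, by simpa using hδt⟩
    simpa [Prod.norm_def, abs_of_nonneg ht, ht] using htρ
  refine (hU.measure_pos μ hne).trans_le (measure_mono fun z hz => ?_)
  have hz2 : ‖z.1‖ ^ 2 + δ ^ 2 < z.2 := hz.2
  rw [prune_cap Set.inter_subset_right]
  refine ⟨⟨Metric.ball_subset_closedBall hz.1, ?_⟩, Set.mem_iInter₂.2 fun i _ => ?_⟩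
  · exact (by nlinarith [sq_nonneg δ] : ‖z.1‖ ^ 2 ≤ z.2)
  · change δ ^ 2 ≤ tangentGap (c i) z
    rw [tangentGap_eq]
    nlinarith [sq_nonneg ‖z.1 - c i‖]

end CutCaps

section CapMeasure

variable [MeasurableSpace F]

theorem prod_cap [BorelSpace F] [SecondCountableTopology F] (μ : Measure F) (δ : ℝ) (c : F) :
    (μ.prod volume) (cap δ c) = ∫⁻ y, ENNReal.ofReal (δ ^ 2 - ‖y - c‖ ^ 2) ∂μ := by
  rw [Measure.prod_apply (measurableSet_cap δ c)]
  refine lintegral_congr fun y => ?_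
  have hslice : Prod.mk y ⁻¹' cap δ c =
      Set.Ico (‖y‖ ^ 2) (‖y‖ ^ 2 + (δ ^ 2 - ‖y - c‖ ^ 2)) := by
    ext t
    exact mem_cap_iff
  rw [hslice, Real.volume_Ico, add_sub_cancel_left]

theorem prod_cap_one_pos (μ : Measure F) [SFinite μ] [μ.IsOpenPosMeasure] :
    0 < (μ.prod volume) (cap 1 (0 : F)) := by
  let U : Set (F × ℝ) := {z | ‖z.1‖ ^ 2 < z.2} ∩ {z | z.2 < 1}
  have hU : IsOpen U :=
    (isOpen_lt (by fun_prop) (by fun_prop)).inter (isOpen_lt (by fun_prop) (by fun_prop))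
  refine (hU.measure_pos (μ.prod volume) ⟨(0, 1 / 2), by norm_num [U]⟩).trans_le
    (measure_mono fun z ⟨hz, hz'⟩ => ⟨?_, ?_⟩)
  · exact (show ‖z.1‖ ^ 2 < z.2 from hz).le
  · simpa [tangentGap] using hz'

variable [FiniteDimensional ℝ F] (μ : Measure F) [μ.IsAddHaarMeasure]

theorem prod_cap_one_ne_top : (μ.prod volume) (cap 1 (0 : F)) ≠ ∞ :=
  measure_ne_top_of_subset (cap_subset_closedBall zero_le_one le_rfl le_rfl (by simp))
    measure_closedBall_lt_top.ne

variable [BorelSpace F]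

theorem prod_cap_eq_mul {δ : ℝ} (hδ : 0 < δ) (c : F) :
    (μ.prod volume) (cap δ c) =
      ENNReal.ofReal (δ ^ (Module.finrank ℝ F + 2)) * (μ.prod volume) (cap 1 (0 : F)) := by
  have hscale : ∀ y : F, ENNReal.ofReal (δ ^ 2 - ‖δ • y‖ ^ 2) =
      ENNReal.ofReal (δ ^ 2) * ENNReal.ofReal (1 ^ 2 - ‖y - 0‖ ^ 2) := fun y => by
    rw [← ENNReal.ofReal_mul (by positivity), norm_smul, Real.norm_of_nonneg hδ.le, sub_zero]
    ring_nf
  rw [prod_cap, prod_cap, lintegral_sub_right_eq_self (fun y => ENNReal.ofReal (δ ^ 2 - ‖y‖ ^ 2)),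
    lintegral_comp_smul μ (by fun_prop) hδ]
  simp_rw [hscale]
  rw [lintegral_const_mul _ (by fun_prop), ← mul_assoc, ← ENNReal.ofReal_mul (by positivity),
    pow_add]

end CapMeasure

end Paraboloid

section Packing

open Metric

variable {F : Type*} [NormedAddCommGroup F] [NormedSpace ℝ F]

theorem packingNumber_ne_top_of_isCompact {X : Type*} [PseudoEMetricSpace X] {A : Set X}
    (hA : IsCompact A) {ε : ℝ≥0} (hε : ε ≠ 0) : packingNumber ε A ≠ ⊤ := by
  obtain ⟨N, -, hN, hcover⟩ := exists_finite_isCover_of_isCompact (half_pos hε.bot_lt).ne' hA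
  refine ne_top_of_le_ne_top hN.encard_lt_top.ne ?_
  rw [← mul_div_cancel₀ ε two_ne_zero]
  exact (packingNumber_two_mul_le_externalCoveringNumber _ A).trans
    hcover.externalCoveringNumber_le_encard

variable [FiniteDimensional ℝ F]

theorem div_pow_finrank_le_card_of_isCover {x : F} {a ε : ℝ≥0} (hε : 0 < ε) {T : Finset F}
    (hT : IsCover ε (closedBall x a) T) : (a / ε) ^ Module.finrank ℝ F ≤ (T.card : ℝ≥0) := by
  borelize F
  let μ : Measure F := Measure.addHaar
  have hball : ∀ (y : F) (r : ℝ≥0),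
      μ (closedBall y r) = (r : ℝ≥0∞) ^ Module.finrank ℝ F * μ (ball 0 1) := fun y r => by
    rw [Measure.addHaar_closedBall μ y r.coe_nonneg, ENNReal.ofReal_pow r.coe_nonneg,
      ENNReal.ofReal_coe_nnreal]
  have hle : (a : ℝ≥0∞) ^ Module.finrank ℝ F * μ (ball 0 1) ≤
      T.card * (ε : ℝ≥0∞) ^ Module.finrank ℝ F * μ (ball 0 1) :=
    calc (a : ℝ≥0∞) ^ Module.finrank ℝ F * μ (ball 0 1)
      _ = μ (closedBall x a) := (hball x a).symm
      _ ≤ μ (⋃ y ∈ T, closedBall y ε) := measure_mono hT.subset_iUnion_closedBall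
      _ ≤ ∑ y ∈ T, μ (closedBall y ε) := measure_biUnion_finset_le T _
      _ = T.card * (ε : ℝ≥0∞) ^ Module.finrank ℝ F * μ (ball 0 1) := by
        simp only [hball, Finset.sum_const, nsmul_eq_mul, mul_assoc]
  have hle' : (a : ℝ≥0∞) ^ Module.finrank ℝ F ≤ T.card * (ε : ℝ≥0∞) ^ Module.finrank ℝ F :=
    (ENNReal.mul_le_mul_iff_left (measure_ball_pos μ 0 one_pos).ne' measure_ball_lt_top.ne).1 hle
  rw [div_pow, div_le_iff₀ (pow_pos hε _)]
  exact_mod_cast hle'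

theorem exists_finset_isSeparated_closedBall (x : F) (a : ℝ≥0) {ε : ℝ≥0} (hε : 0 < ε) :
    ∃ T : Finset F, (T : Set F) ⊆ closedBall x a ∧ IsSeparated ε (T : Set F) ∧
      (a / ε) ^ Module.finrank ℝ F ≤ (T.card : ℝ≥0) := by
  have : ProperSpace F := FiniteDimensional.proper ℝ F
  have hfin := packingNumber_ne_top_of_isCompact (isCompact_closedBall x (a : ℝ)) hε.ne'
  have hTfin : (maximalSeparatedSet ε (closedBall x (a : ℝ))).Finite := by
    rwa [← Set.encard_ne_top_iff, encard_maximalSeparatedSet hfin]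
  have hcoe := hTfin.coe_toFinset
  refine ⟨hTfin.toFinset, ?_, ?_, div_pow_finrank_le_card_of_isCover (x := x) hε ?_⟩ <;> rw [hcoe]
  exacts [maximalSeparatedSet_subset, isSeparated_maximalSeparatedSet,
    isCover_maximalSeparatedSet hfin]

end Packing

section Chart

variable {V F : Type*} [NormedAddCommGroup V] [InnerProductSpace ℝ V] [FiniteDimensional ℝ V]
  [MeasurableSpace V] [BorelSpace V] [NormedAddCommGroup F] [InnerProductSpace ℝ F]
  [FiniteDimensional ℝ F] [MeasurableSpace F] [BorelSpace F]

theorem exists_measurePreserving_affineEquiv_prod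
    (hdim : Module.finrank ℝ V = Module.finrank ℝ F + 1) (p : V) :
    ∃ T : V ≃ᴬ[ℝ] F × ℝ, MeasurePreserving T ∧ T p = 0 := by
  have hcard : Module.finrank ℝ V = Module.finrank ℝ (WithLp 2 (F × ℝ)) := by
    rw [hdim, (WithLp.linearEquiv 2 ℝ (F × ℝ)).finrank_eq, Module.finrank_prod,
      Module.finrank_self]
  let f : V ≃ₗᵢ[ℝ] WithLp 2 (F × ℝ) :=
    (stdOrthonormalBasis ℝ V).equiv (stdOrthonormalBasis ℝ _) (finCongr hcard)
  let L : V ≃L[ℝ] F × ℝ :=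
    f.toContinuousLinearEquiv.trans (WithLp.prodContinuousLinearEquiv 2 ℝ F ℝ)
  have hL : MeasurePreserving L := (WithLp.volume_preserving_ofLp F ℝ).comp f.measurePreserving
  exact ⟨(ContinuousAffineEquiv.constVAdd ℝ V (-p)).trans L.toContinuousAffineEquiv,
    hL.comp (measurePreserving_add_left volume (-p)),
    (congrArg L (neg_add_cancel p)).trans (map_zero L)⟩

variable {d : ℕ} {E : Set (EuclideanSpace ℝ (Fin d))} {T : EuclideanSpace ℝ (Fin d) ≃ᴬ[ℝ] F × ℝ}

theorem preimage_mem_convexClass (hT : MeasurePreserving T) {C : Set (F × ℝ)}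
    (hCE : T ⁻¹' C ⊆ E) (hconv : Convex ℝ C) (hclosed : IsClosed C) (hpos : 0 < volume C) :
    T ⁻¹' C ∈ ConvexClass E := by
  refine ⟨hCE, hconv.affine_preimage T.toAffineMap, hclosed.preimage T.continuous, ?_⟩
  rwa [hT.measure_preimage hclosed.measurableSet.nullMeasurableSet]

theorem card_mul_le_minimaxRisk {ι : Type*} [Fintype ι] (hT : MeasurePreserving T) {δ ρ : ℝ}
    (hE : T ⁻¹' Metric.closedBall 0 ρ ⊆ E) (hδ : 0 < δ) (hδρ : δ ^ 2 < ρ) {c : ι → F}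
    (hc : ∀ i, cap δ (c i) ⊆ Metric.closedBall 0 ρ)
    (hsep : Pairwise fun i j => 2 * δ ≤ dist (c i) (c j)) (lam : ℝ≥0) :
    Fintype.card ι * ENNReal.ofReal
      ((δ ^ (Module.finrank ℝ F + 2) * volume.real (cap 1 (0 : F))) ^ 2 / 4 *
        Real.exp (-(lam * (δ ^ (Module.finrank ℝ F + 2) * volume.real (cap 1 (0 : F)))))) ≤
      minimaxRisk E lam := by
  let K : Set (F × ℝ) := Metric.closedBall 0 ρ ∩ paraboloid F
  have hKpar : K ⊆ paraboloid F := Set.inter_subset_right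
  have hKclosed : IsClosed K := Metric.isClosed_closedBall.inter isClosed_paraboloid
  have hKconv : Convex ℝ K := (convex_closedBall 0 ρ).inter convex_paraboloid
  have hKfin : volume (T ⁻¹' K) ≠ ∞ := by
    rw [hT.measure_preimage hKclosed.measurableSet.nullMeasurableSet]
    exact measure_ne_top_of_subset Set.inter_subset_left measure_closedBall_lt_top.ne
  have hcap : ∀ i, volume.real (T ⁻¹' cap δ (c i)) =
      δ ^ (Module.finrank ℝ F + 2) * volume.real (cap 1 (0 : F)) := fun i => by
    rw [hT.measureReal_preimage (measurableSet_cap δ (c i)).nullMeasurableSet, Measure.real,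
      Measure.volume_eq_prod, prod_cap_eq_mul volume hδ, ENNReal.toReal_mul,
      ENNReal.toReal_ofReal (by positivity), Measure.real]
  have hbodies : ∀ s : Finset ι,
      prune (T ⁻¹' K) (fun i => T ⁻¹' cap δ (c i)) s ∈ ConvexClass E := fun s => by
    rw [← preimage_prune]
    exact preimage_mem_convexClass hT
      ((Set.preimage_mono ((prune_subset _ _ _).trans Set.inter_subset_left)).trans hE)
      (convex_prune_cap hKpar hKconv c s) (isClosed_prune_cap hKpar hKclosed c s)
      (measure_prune_cap_pos volume hδρ c s)
  have hrisk := sum_sq_mul_exp_le_minimaxRisk hKfin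
    (fun i => T.continuous.measurable (measurableSet_cap δ (c i)))
    (fun i => Set.preimage_mono (Set.subset_inter (hc i) (Set.sep_subset _ _)))
    (fun i j hij => (disjoint_cap hδ.le (hsep hij)).preimage T) hbodies lam
  simpa only [hcap, Finset.sum_const, Finset.card_univ, nsmul_eq_mul] using hrisk

theorem mul_pow_le_minimaxRisk (hT : MeasurePreserving T) {a δ : ℝ≥0}
    (hE : T ⁻¹' Metric.closedBall 0 (5 * a) ⊆ E) (ha : a ≤ 1) (hδ : 0 < δ) (hδa : δ ≤ a) :
    ENNReal.ofReal ((a / 2) ^ Module.finrank ℝ F * (volume.real (cap 1 (0 : F)) ^ 2 / 4 *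
      Real.exp (-volume.real (cap 1 (0 : F))))) * (δ : ℝ≥0∞) ^ (Module.finrank ℝ F + 4) ≤
      minimaxRisk E (δ ^ (Module.finrank ℝ F + 2))⁻¹ := by
  obtain ⟨S, hSball, hSsep, hScard⟩ :=
    exists_finset_isSeparated_closedBall (0 : F) a (show 0 < 2 * δ by positivity)
  have hδ' : (0 : ℝ) < δ := hδ
  have hδρ : (δ : ℝ) ^ 2 < 5 * a := by
    have : (δ : ℝ) ≤ a := hδa
    have : (a : ℝ) ≤ 1 := ha
    nlinarith
  have hsep : Pairwise fun c c' : S => 2 * (δ : ℝ) ≤ dist (c : F) c' := fun c c' hne => by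
    have hlt : ((2 * δ : ℝ≥0) : ℝ≥0∞) < edist (c : F) c' :=
      hSsep c.2 c'.2 (Subtype.coe_injective.ne hne)
    rw [edist_nndist, ENNReal.coe_lt_coe, ← NNReal.coe_lt_coe] at hlt
    exact_mod_cast hlt.le
  have hrisk := card_mul_le_minimaxRisk hT hE hδ' hδρ
    (fun c : S => cap_subset_closedBall hδ'.le hδa ha (mem_closedBall_zero_iff.1 (hSball c.2)))
    hsep (δ ^ (Module.finrank ℝ F + 2))⁻¹
  refine le_trans ?_ hrisk
  set n := Module.finrank ℝ F
  set v := volume.real (cap 1 (0 : F))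
  have hScard' : ((a : ℝ) / (2 * δ)) ^ n ≤ S.card := by exact_mod_cast hScard
  have hexp : ((δ ^ (n + 2))⁻¹ : ℝ≥0) * ((δ : ℝ) ^ (n + 2) * v) = v := by
    push_cast
    field_simp
  rw [hexp, Fintype.card_coe, ← ENNReal.ofReal_natCast, ← ENNReal.ofReal_mul (by positivity),
    ← ENNReal.ofReal_coe_nnreal, ← ENNReal.ofReal_pow hδ'.le, ← ENNReal.ofReal_mul (by positivity)]
  refine ENNReal.ofReal_le_ofReal ?_
  calc ((a : ℝ) / 2) ^ n * (v ^ 2 / 4 * Real.exp (-v)) * δ ^ (n + 4)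
    _ = (a / (2 * δ)) ^ n * ((δ ^ (n + 2) * v) ^ 2 / 4 * Real.exp (-v)) := by
      rw [div_mul_eq_div_div, div_pow _ (δ : ℝ)]
      field_simp
      ring
    _ ≤ S.card * ((δ ^ (n + 2) * v) ^ 2 / 4 * Real.exp (-v)) := by gcongr

theorem exists_preimage_closedBall_subset (hdim : d = Module.finrank ℝ F + 1)
    (hE : (interior E).Nonempty) :
    ∃ T : EuclideanSpace ℝ (Fin d) ≃ᴬ[ℝ] F × ℝ, MeasurePreserving T ∧
      ∃ ρ > 0, T ⁻¹' Metric.closedBall 0 ρ ⊆ E := by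
  obtain ⟨p, hp⟩ := hE
  obtain ⟨T, hT, hTp⟩ :=
    exists_measurePreserving_affineEquiv_prod (F := F) (by rwa [finrank_euclideanSpace_fin]) p
  refine ⟨T, hT, ?_⟩
  have hnhds : T.symm ⁻¹' E ∈ nhds (0 : F × ℝ) :=
    T.symm.continuous.tendsto' 0 p (by rw [← hTp, T.symm_apply_apply])
      (mem_interior_iff_mem_nhds.1 hp)
  obtain ⟨ρ, hρ, hsub⟩ := Metric.nhds_basis_closedBall.mem_iff.1 hnhds
  exact ⟨ρ, hρ, fun x hx => by simpa using hsub hx⟩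

end Chart

theorem exists_mul_pow_le_minimaxRisk {d : ℕ} (hd : 1 ≤ d) {E : Set (EuclideanSpace ℝ (Fin d))}
    (hE : (interior E).Nonempty) :
    ∃ c > (0 : ℝ≥0∞), ∃ δ₀ > (0 : ℝ≥0), ∀ δ, 0 < δ → δ ≤ δ₀ →
      c * (δ : ℝ≥0∞) ^ (d + 3) ≤ minimaxRisk E (δ ^ (d + 1))⁻¹ := by
  obtain ⟨n, rfl⟩ := Nat.exists_eq_add_of_le' hd
  obtain ⟨T, hT, ρ, hρ, hTE⟩ :=
    exists_preimage_closedBall_subset (F := EuclideanSpace ℝ (Fin n)) (by simp) hE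
  lift ρ to ℝ≥0 using hρ.le
  let a : ℝ≥0 := min 1 (ρ / 5)
  have ha : 0 < a := lt_min one_pos (div_pos hρ (by norm_num))
  have haE : T ⁻¹' Metric.closedBall 0 (5 * a) ⊆ E := by
    refine (Set.preimage_mono (Metric.closedBall_subset_closedBall ?_)).trans hTE
    have : a ≤ ρ / 5 := min_le_right _ _
    rw [mul_comm]
    exact_mod_cast (le_div_iff₀ (by norm_num)).1 this
  have hv : 0 < volume.real (cap 1 (0 : EuclideanSpace ℝ (Fin n))) :=
    ENNReal.toReal_pos (prod_cap_one_pos volume).ne' (prod_cap_one_ne_top volume)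
  have hbound := fun δ : ℝ≥0 => mul_pow_le_minimaxRisk (δ := δ) hT haE (min_le_left _ _)
  simp only [finrank_euclideanSpace_fin] at hbound
  exact ⟨_, ENNReal.ofReal_pos.2 (by positivity), a, ha, hbound⟩

theorem liminf_rpow_mul_pos {f : ℝ≥0 → ℝ≥0∞} {c : ℝ≥0∞} (hc : 0 < c) {δ₀ : ℝ≥0} (hδ₀ : 0 < δ₀)
    (k : ℕ) {l : ℕ} (hl : l ≠ 0)
    (h : ∀ δ, 0 < δ → δ ≤ δ₀ → c * (δ : ℝ≥0∞) ^ k ≤ f (δ ^ l)⁻¹) :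
    0 < Filter.liminf (fun lam : ℝ≥0 => ((lam ^ ((k : ℝ) / l) : ℝ≥0) : ℝ≥0∞) * f lam)
      Filter.atTop := by
  refine hc.trans_le (Filter.le_liminf_of_le (by isBoundedDefault) ?_)
  filter_upwards [Filter.eventually_ge_atTop (δ₀ ^ l)⁻¹] with lam hlam
  have hlam_pos : 0 < lam := (inv_pos.2 (pow_pos hδ₀ l)).trans_le hlam
  let δ : ℝ≥0 := (lam ^ (l⁻¹ : ℝ))⁻¹
  have hδ : 0 < δ := inv_pos.2 (NNReal.rpow_pos hlam_pos)
  have hδl : δ ^ l = lam⁻¹ := by rw [inv_pow, NNReal.rpow_inv_natCast_pow lam hl]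
  have hδk : lam ^ ((k : ℝ) / l) * δ ^ k = 1 := by
    rw [inv_pow, ← NNReal.rpow_mul_natCast, inv_mul_eq_div,
      mul_inv_cancel₀ (NNReal.rpow_pos hlam_pos).ne']
  have hδ_le : δ ≤ δ₀ := by
    refine (pow_le_pow_iff_left₀ hδ.le hδ₀.le hl).1 ?_
    rw [hδl]
    exact inv_le_of_inv_le₀ (pow_pos hδ₀ l) hlam
  calc c
    _ = ((lam ^ ((k : ℝ) / l) * δ ^ k : ℝ≥0) : ℝ≥0∞) * c := by
      rw [hδk, ENNReal.coe_one, one_mul]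
    _ = ((lam ^ ((k : ℝ) / l) : ℝ≥0) : ℝ≥0∞) * (c * (δ : ℝ≥0∞) ^ k) := by
      push_cast
      ring
    _ ≤ ((lam ^ ((k : ℝ) / l) : ℝ≥0) : ℝ≥0∞) * f lam := by
      gcongr
      simpa only [hδl, inv_inv] using h δ hδ hδ_le

end ConvexSupport

end

theorem mainTheorem7_general (d : ℕ) (hd : 1 ≤ d) (E : Set (EuclideanSpace ℝ (Fin d)))
    (hEint : (interior E).Nonempty) :
    0 < Filter.liminf
      (fun lam : ℝ≥0 =>
        ((lam ^ (((d : ℝ) + 3) / ((d : ℝ) + 1)) : ℝ≥0) : ℝ≥0∞) *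
          ConvexSupport.minimaxRisk E lam)
      Filter.atTop := by
  obtain ⟨c, hc, δ₀, hδ₀, hrisk⟩ := ConvexSupport.exists_mul_pow_le_minimaxRisk hd hEint
  simpa only [Nat.cast_add, Nat.cast_ofNat, Nat.cast_one] using
    ConvexSupport.liminf_rpow_mul_pos hc hδ₀ (d + 3) (l := d + 1) d.succ_ne_zero hrisk

theorem mainTheorem7 (d : ℕ) (hd : 1 ≤ d) (E : Set (EuclideanSpace ℝ (Fin d)))
    (hEcompact : IsCompact E) (hEconvex : Convex ℝ E) (hEint : (interior E).Nonempty) :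
    0 < Filter.liminf
      (fun lam : ℝ≥0 =>
        ((lam ^ (((d : ℝ) + 3) / ((d : ℝ) + 1)) : ℝ≥0) : ℝ≥0∞) *
          ConvexSupport.minimaxRisk E lam)
      Filter.atTop :=
  mainTheorem7_general d hd E hEint
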